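/- **Setting.** All Hilbert spaces are finite-dimensional. Fix integers $w\ge 1$ and $d\ge 1$, and let $A=\{k\pi/4: 0\le k\le 7\}$. The brickwork graph has vertices $(i,j)$, $1\le i\le w$, $1\le j\le d$, the horizontal edges $(i,j)\sim(i,j+1)$, and, for every column $c\equiv 3 \pmod 8$ and odd $i$ and every column $c\equiv 7\pmod 8$ and even $i$, the vertical edges $(i,c)\sim(i+1,c)$ and $(i,c+2)\sim(i+1,c+2)$ (whenever both end points are vertices). For $\theta\in A$ let $|+_\theta\rangle=(|0\rangle+e^{i\theta}|1\rangle)/\sqrt2$. **The protocol.** Alice holds angles $\boldsymbol a=(a_{i,j})$ with $a_{i,j}\in A$ (the last column is not used). She picks $\theta_{i,j}\in A$ for all vertices, and bits $r_{i,j}$ for $j\le d-1$, all uniformly and independently. 1. Alice sends Bob a qubit in the state $|+_{\theta_{1,1}}\rangle$. (Bob himself prepares the qubits $(2,1),\dots,(w,1)$ in the maximally mixed state.) 2. For $j=1,\dots,d-1$ and, for each $j$, for $i=1,\dots,w$: Alice sends Bob a qubit in the state $|+_{\theta_{i,j+1}}\rangle$ and the angle $\delta_{i,j}=a'_{i,j}+\theta_{i,j}+r_{i,j}\pi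 \pmod{2\pi}$, where $a'_{i,j}=(-1)^{S^x_{i,j}}a_{i,j}+S^z_{i,j}\pi$. (Bob applies the controlled-$Z$ gates between $(i,j)$ and its neighbours $(k,l)$ with $k\ge i$, $l\ge j$, and measures qubit $(i,j)$ in the basis $|+_{\delta_{i,j}}\rangle,|+_{\delta_{i,j}+\pi}\rangle$.) Bob answers with a bit $b_{i,j}$, and Alice sets $s_{i,j}=b_{i,j}+r_{i,j}\bmod 2$. Here $S^x_{i,j}=s_{i,j-1}$ for $j>1$ and $S^x_{i,1}=0$, while $S^z_{i,j}=\sum_{(k,l)\sim(i,j),\,l\le j}s_{k,l-1}\bmod 2$ for $j>2$ and $S^z_{i,j}=0$ for $j\le 2$. 3. Bob sends Alice $w$ qubits (the final layer). Alice undoes the rotations by $\theta_{i,d}$ on them and applies the corrections $X^{S^x_{i,d}}Z^{S^z_{i,d}}$; the first qubit is the output. **Deviations.** Bob may replace his actions by arbitrary ones: a CPTP map from his initial system $\mathcal H_B$ and the first qubit to a private memory; in each round a quantum instrument, acting on his memory, the new qubit and the register holding $\delta_{i,j}$, whose classical outcome is his answer $b_{i,j}$ and whose quantum output is his new memory; and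 at the end a CPTP map from his memory to $w$ qubits, which go to Alice, and his final system $\mathcal H_{B'}$ (for instance $\mathcal H_{B'}=\mathcal H_B$). **Theorem.** The protocol is blind in the stand-alone sense: for all $w,d\ge1$, all systems $\mathcal H_B,\mathcal H_{B'}$ and every deviation by Bob, there is a completely positive trace-preserving map $\mathcal E:\mathcal L(\mathcal H_B)\to\mathcal L(\mathcal H_{B'})$ such that for every joint initial state $\rho_{AB}$ of Bob's system and Alice's system (the latter consisting of a register that holds $\boldsymbol a$ and an arbitrary further system, so that $\boldsymbol a$ may be correlated or entangled with Bob's system), $$\mathrm{Tr}_A(\sigma_{AB})=\mathcal E\big(\mathrm{Tr}_A(\rho_{AB})\big),$$ where $\sigma_{AB}$ is the joint final state, averaged over Alice's random choices $\theta,r$ and summed over Bob's answers. The map $\mathcal E$ does not depend on $\rho_{AB}$ or on $\boldsymbol a$. -/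

import Mathlib

open scoped ComplexOrder

universe u

noncomputable section

/-! ### States, partial trace and quantum channels

The operators on the Hilbert space with orthonormal basis indexed by a finite type `m` are the
matrices `Matrix m m ℂ`; a tensor product of two such spaces is indexed by the product type. -/

/-- A (mixed) quantum state: a positive semidefinite matrix of trace one. -/
def IsState {m : Type*} [Fintype m] (ρ : Matrix m m ℂ) : Prop :=
  ρ.PosSemidef ∧ ρ.trace = 1

/-- The partial trace over Alice's (left) tensor factor. -/
def traceAlice {A B : Type*} [Fintype A] (X : Matrix (A × B) (A × B) ℂ) : Matrix B B ℂ :=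
  Matrix.of fun b b' => ∑ a, X (a, b) (a, b')

/-- The action of `id ⊗ Φ` on a bipartite operator. -/
def idTensor {A m n : Type*} (Φ : Matrix m m ℂ →ₗ[ℂ] Matrix n n ℂ)
    (X : Matrix (A × m) (A × m) ℂ) : Matrix (A × n) (A × n) ℂ :=
  Matrix.of fun p q => Φ (Matrix.of fun x y => X (p.1, x) (q.1, y)) p.2 q.2

/-- Complete positivity: `id_k ⊗ Φ` preserves positive semidefiniteness for every `k`. -/
def IsCompletelyPositive {m n : Type*} (Φ : Matrix m m ℂ →ₗ[ℂ] Matrix n n ℂ) : Prop :=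
  ∀ (k : ℕ) (X : Matrix (Fin k × m) (Fin k × m) ℂ), X.PosSemidef → (idTensor Φ X).PosSemidef

/-- Trace preservation. -/
def IsTracePreserving {m n : Type*} [Fintype m] [Fintype n]
    (Φ : Matrix m m ℂ →ₗ[ℂ] Matrix n n ℂ) : Prop :=
  ∀ X, (Φ X).trace = X.trace

/-- Completely positive trace-preserving maps. -/
def IsCPTP {m n : Type*} [Fintype m] [Fintype n]
    (Φ : Matrix m m ℂ →ₗ[ℂ] Matrix n n ℂ) : Prop :=
  IsCompletelyPositive Φ ∧ IsTracePreserving Φ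

/-- Alice sends to Bob a fresh system in the state `τ`: the state of (Alice's system) ⊗ (Bob's
system) is tensored with `τ`, on Bob's side. -/
def sendToBob {A m q : Type*} (X : Matrix (A × m) (A × m) ℂ) (τ : Matrix q q ℂ) :
    Matrix (A × (m × q)) (A × (m × q)) ℂ :=
  Matrix.of fun x y => X (x.1, x.2.1) (y.1, y.2.1) * τ x.2.2 y.2.2

/-! ### Blindness -/

/-- Stand-alone blindness of a two-party protocol.  For each behaviour `s` of Bob, `run s` sends
the joint initial state of Alice and Bob to their joint final state, averaged over Alice's random
choices.  The protocol is blind if, whatever Bob does, there is one CPTP map that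
gives Bob's reduced final state from his reduced initial state, for all joint initial states. -/
def IsBlind {S A B A' B' : Type*} [Fintype A] [Fintype B] [Fintype A'] [Fintype B']
    (run : S → Matrix (A × B) (A × B) ℂ → Matrix (A' × B') (A' × B') ℂ) : Prop :=
  ∀ s : S, ∃ E : Matrix B B ℂ →ₗ[ℂ] Matrix B' B' ℂ, IsCPTP E ∧
    ∀ ρ : Matrix (A × B) (A × B) ℂ, IsState ρ → traceAlice (run s ρ) = E (traceAlice ρ)

/-! ### The brickwork graph

Vertices are pairs (row, column).  Rows and columns are numbered from one in the mathematics and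
from zero in `Fin`, whence the shifts `+ 1` below. -/

/-- With one-based numbering: there is a vertical edge between `(i, j)` and `(i + 1, j)`.  For each
column `c ≡ 3 (mod 8)` and odd `i`, and each column `c ≡ 7 (mod 8)` and even `i`, there are such
edges in the columns `c` and `c + 2`. -/
def HasRung (i j : ℕ) : Prop :=
  ∃ c : ℕ, ((c % 8 = 3 ∧ Odd i) ∨ (c % 8 = 7 ∧ Even i)) ∧ (j = c ∨ j = c + 2)

/-- The brickwork graph with `w` rows and `d` columns. -/
def brickwork (w d : ℕ) : SimpleGraph (Fin w × Fin d) :=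
  SimpleGraph.fromRel fun u v =>
    (v.1 = u.1 ∧ (v.2 : ℕ) = u.2 + 1) ∨
    ((v.1 : ℕ) = u.1 + 1 ∧ v.2 = u.2 ∧ HasRung (u.1 + 1) (u.2 + 1))

/-! ### Alice's side of the protocol

There are `w` rows and `d = n + 1` columns, of which the first `n` are measured.  The element `k` of
`ZMod 8` stands for the angle `k π / 4`, so that `4` stands for `π`.  Bits are elements of
`ZMod 2`. -/

/-- Vectors of angles, one for each vertex of the graph. -/
abbrev Angles (w n : ℕ) : Type := Fin w → Fin (n + 1) → ZMod 8

/-- Vectors of bits, one for each measured vertex. -/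
abbrev Bits (w n : ℕ) : Type := Fin w → Fin n → ZMod 2

/-- The phase `exp (i k π / 4)`. -/
def phase (k : ZMod 8) : ℂ :=
  Complex.exp (Complex.I * ((k.val : ℂ) * (Real.pi / 4 : ℂ)))

/-- The vector `(|0⟩ + exp (i θ) |1⟩) / √2`, that is `R_z(θ) |+⟩` up to a global phase. -/
def plusKet (θ : ZMod 8) : Fin 2 → ℂ :=
  fun x => (if x = 0 then 1 else phase θ) / (Real.sqrt 2 : ℂ)

/-- The state `|+_θ⟩⟨+_θ|`. -/
def plusState (θ : ZMod 8) : Matrix (Fin 2) (Fin 2) ℂ :=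
  Matrix.vecMulVec (plusKet θ) (star (plusKet θ))

/-- The state `|δ⟩⟨δ|` of three qubits that encodes the classical message `δ`. -/
def angleState (δ : ZMod 8) : Matrix (ZMod 8) (ZMod 8) ℂ :=
  Matrix.single δ δ 1

/-- The exponent `S^x` of the `X` correction at `(i, j)`, given the corrected outcomes `s`:
it is `s_{i, j-1}`, and zero in the first column. -/
def corrX {w n : ℕ} (s : Bits w n) (i : Fin w) (j : Fin (n + 1)) : ZMod 2 :=
  Fin.cases 0 (fun j' => s i j') j

open Classical in
/-- The exponent `S^z` of the `Z` correction at `(i, j)`: the sum of `s_{k, l-1}` over the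
neighbours `(k, l)` of `(i, j)` with `l ≤ j`, and zero in the first two columns. -/
def corrZ {w n : ℕ} (s : Bits w n) (i : Fin w) (j : Fin (n + 1)) : ZMod 2 :=
  if (j : ℕ) < 2 then 0 else
    ∑ k : Fin w, ∑ l : Fin n,
      if (brickwork w (n + 1)).Adj (k, l.succ) (i, j) ∧ l.succ ≤ j then s k l else 0

/-- The corrected measurement angle `a' = (-1)^{S^x} a + S^z π`. -/
def correctedAngle {w n : ℕ} (a : Angles w n) (s : Bits w n) (i : Fin w) (j : Fin (n + 1)) :
    ZMod 8 :=
  (-1) ^ (corrX s i j).val * a i j + ((corrZ s i j).val : ZMod 8) * 4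

/-- The angle `δ = a' + θ + r π` announced to Bob for the measured vertex `(i, j)`; Alice's random
choices are `θ` and `r`, and `b` holds Bob's answers, so that the corrected outcomes are
`s = b + r`.  Only answers for vertices measured earlier enter. -/
def announcedAngle {w n : ℕ} (a θ : Angles w n) (r b : Bits w n) (i : Fin w) (j : Fin n) :
    ZMod 8 :=
  correctedAngle a (b + r) i j.castSucc + θ i j.castSucc + ((r i j).val : ZMod 8) * 4

/-- Alice's final correction on output qubit `i`: undo the rotation by `θ_{i, d}`, then apply
`X^{S^x} Z^{S^z}`. -/
def outputCorrection {w n : ℕ} (θ : Angles w n) (s : Bits w n) (i : Fin w) :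
    Matrix (Fin 2) (Fin 2) ℂ :=
  !![0, 1; 1, 0] ^ (corrX s i (Fin.last n)).val *
    !![1, 0; 0, -1] ^ (corrZ s i (Fin.last n)).val *
    !![1, 0; 0, phase (-θ i (Fin.last n))]

/-- The tensor product over the rows of Alice's final corrections. -/
def layerCorrection {w n : ℕ} (θ : Angles w n) (s : Bits w n) :
    Matrix (Fin w → Fin 2) (Fin w → Fin 2) ℂ :=
  Matrix.of fun x y => ∏ i, outputCorrection θ s i (x i) (y i)

/-- The operation `X ↦ (1 ⊗ C ⊗ 1) X (1 ⊗ C ⊗ 1)ᴴ`. -/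
def conjMiddle {R Q B : Type*} [Fintype Q] (C : Matrix Q Q ℂ)
    (X : Matrix (R × (Q × B)) (R × (Q × B)) ℂ) : Matrix (R × (Q × B)) (R × (Q × B)) ℂ :=
  Matrix.of fun p q => ∑ x, ∑ y,
    C p.2.1 x * X (p.1, (x, p.2.2)) (q.1, (y, q.2.2)) * star (C q.2.1 y)

/-! ### Bob's side of the protocol -/

/-- The vertex (column, row) treated in round `t`: column after column, and from top to bottom in
each column, so `t = column * w + row`. -/
def roundVertex {w n : ℕ} (t : Fin (n * w)) : Fin n × Fin w :=
  finProdFinEquiv.symm t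

/-- An arbitrary behaviour of Bob with initial system `B` and final system `B'`. -/
structure BobStrategy (w n : ℕ) (B B' : Type u) [Fintype B] [Fintype B'] where
  /-- Bob's private system before each round, and after the last one. -/
  Mem : Fin (n * w + 1) → Type u
  [memFintype : ∀ t, Fintype (Mem t)]
  /-- What Bob does on receipt of the qubit with tag `(1, 1)`. -/
  init : Matrix (B × Fin 2) (B × Fin 2) ℂ →ₗ[ℂ] Matrix (Mem 0) (Mem 0) ℂ
  init_cptp : IsCPTP init
  /-- What Bob does in round `t`, when he has received a qubit and an angle and answers with
  a bit `b`: a quantum instrument with outcome `b`. -/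
  act : (t : Fin (n * w)) → ZMod 2 →
    Matrix (Mem t.castSucc × (Fin 2 × ZMod 8)) (Mem t.castSucc × (Fin 2 × ZMod 8)) ℂ →ₗ[ℂ]
      Matrix (Mem t.succ) (Mem t.succ) ℂ
  act_cp : ∀ t b, IsCompletelyPositive (act t b)
  act_tp : ∀ t, IsTracePreserving (∑ b, act t b)
  /-- How Bob produces the final layer of qubits, which goes to Alice, and his final system. -/
  final : Matrix (Mem (Fin.last (n * w))) (Mem (Fin.last (n * w))) ℂ →ₗ[ℂ]
    Matrix ((Fin w → Fin 2) × B') ((Fin w → Fin 2) × B') ℂ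
  final_cptp : IsCPTP final

/-! ### The run of the protocol

Alice's initial system consists of a register that holds her angle vector and of an arbitrary
further system `R`. -/

section Run

variable {w n : ℕ} [NeZero w] {R B B' : Type u} [Fintype B] [Fintype B']

/-- The unnormalised joint state of `R` and Bob after the first `t` rounds, in the branch where
Alice's angles are `a`, her random choices `θ` and `r`, and Bob's answers `b`. -/
def branchState (S : BobStrategy w n B B') (a θ : Angles w n) (r b : Bits w n)
    (ρ : Matrix (R × B) (R × B) ℂ) (t : Fin (n * w + 1)) :
    Matrix (R × S.Mem t) (R × S.Mem t) ℂ :=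
  Fin.induction (motive := fun t => Matrix (R × S.Mem t) (R × S.Mem t) ℂ)
    (idTensor S.init (sendToBob ρ (plusState (θ 0 0))))
    (fun t X =>
      let j := (roundVertex t).1
      let i := (roundVertex t).2
      idTensor (S.act t (b i j))
        (sendToBob X (Matrix.kronecker (plusState (θ i j.succ))
          (angleState (announcedAngle a θ r b i j)))))
    t

/-- The unnormalised joint state of `R`, the corrected output layer and Bob at the end of a
branch. -/
def branchFinal (S : BobStrategy w n B B') (a θ : Angles w n) (r b : Bits w n)
    (ρ : Matrix (R × B) (R × B) ℂ) :
    Matrix (R × ((Fin w → Fin 2) × B')) (R × ((Fin w → Fin 2) × B')) ℂ :=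
  conjMiddle (layerCorrection θ (b + r))
    (idTensor S.final (branchState S a θ r b ρ (Fin.last (n * w))))

/-- The block of the joint state in which Alice's angle register holds `a`. -/
def angleBlock {M : Type*} (ρ : Matrix ((Angles w n × R) × M) ((Angles w n × R) × M) ℂ)
    (a : Angles w n) : Matrix (R × M) (R × M) ℂ :=
  Matrix.of fun x y => ρ ((a, x.1), x.2) ((a, y.1), y.2)

/-- The joint final state of the protocol.  Alice reads the angle vector `a` in her register, and
picks `θ` and `r` uniformly and independently; the answers of Bob are summed over. Alice ends with
the angle register, the system `R` and the corrected final layer (whose first qubit is the output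
of the computation), and Bob with `B'`. -/
def blindProtocolRun (S : BobStrategy w n B B')
    (ρ : Matrix ((Angles w n × R) × B) ((Angles w n × R) × B) ℂ) :
    Matrix (((Angles w n × R) × (Fin w → Fin 2)) × B')
      (((Angles w n × R) × (Fin w → Fin 2)) × B') ℂ :=
  Matrix.of fun p q =>
    if p.1.1.1 = q.1.1.1 then
      ((Fintype.card (Angles w n) : ℂ)⁻¹ * (Fintype.card (Bits w n) : ℂ)⁻¹) *
        ∑ θ : Angles w n, ∑ r : Bits w n, ∑ b : Bits w n,
          branchFinal S p.1.1.1 θ r b (angleBlock ρ p.1.1.1)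
            (p.1.1.2, (p.1.2, p.2)) (q.1.1.2, (q.1.2, q.2))
    else 0

end Run

end

/-! For a fixed answer string `b`, Bob's part of a run is a composite of fixed linear maps, additive
in each message state (`bobState`). Alice's final corrections depend on her secrets, but act
isometrically on a layer that is traced out, so only the tags `θ` and the announced angles matter.

Two kinds of randomness hide `a`. First, for fixed `r` and `b`, translating the uniform `θ` by `a' +
rπ` turns the announced angles into `θ` itself and the tags into `θ - a' - rπ`. Second, `|+_θ⟩⟨+_θ|
+ |+_{θ+π}⟩⟨+_{θ+π}| = 1`, so summing over `r` at one vertex removes the offset `a'` there, as long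
as nothing else depends on that bit. The corrected angle at a vertex involves only `r` in earlier
columns (`correctedAngle_congr`), so the offsets can be removed from the last column backwards
(`sum_shift_eq_of_causal`). Hence the average is free of `a` (`sum_bobFinal`).

In the resulting expression the messages no longer depend on Bob's answers. Summing over `b`
therefore completes each instrument to a trace-preserving map, and the average is a channel
(`isCPTP_bobChannel`). -/

noncomputable section

/-! ### Summing out uniformly random bits -/

/-- Summing over a vector of bits, and adding a sum over a fresh bit at one position. -/
theorem two_nsmul_sum_bits {V E : Type*} [Fintype V] [DecidableEq V] [AddCommGroup E] (v : V)
    (f : ZMod 2 → (V → ZMod 2) → E)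
    (hf : ∀ β b b', (∀ u, u ≠ v → b u = b' u) → f β b = f β b') :
    2 • ∑ b : V → ZMod 2, f (b v) b = ∑ b : V → ZMod 2, ∑ β, f β b := by
  -- The two values of `β` are `b v` and its flip; flipping the bit at `v` permutes the vectors `b`
  -- and leaves `f β` unchanged.
  have key : ∀ b : V → ZMod 2,
      ∑ β, f β b = f (b v) b + f ((b + Pi.single v 1 : V → ZMod 2) v) (b + Pi.single v 1) := by
    intro b
    rw [hf ((b + Pi.single v 1 : V → ZMod 2) v) (b + Pi.single v 1) b
      (fun u hu => by simp [hu])]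
    have h2 : ∀ g : ZMod 2 → E, ∑ β, g β = g 0 + g 1 := fun g => Fin.sum_univ_two g
    rw [h2]
    simp only [Pi.add_apply, Pi.single_eq_same]
    generalize b v = x
    fin_cases x
    · change _ = f 0 b + f (0 + 1) b
      rw [zero_add]
    · change _ = f 1 b + f (1 + 1) b
      rw [show (1 : ZMod 2) + 1 = 0 from by decide, add_comm]
  have hshift : ∑ b : V → ZMod 2, f ((b + Pi.single v 1 : V → ZMod 2) v) (b + Pi.single v 1) =
      ∑ b : V → ZMod 2, f (b v) b :=
    Equiv.sum_comp (Equiv.addRight (Pi.single v (1 : ZMod 2) : V → ZMod 2)) (fun b => f (b v) b)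
  rw [Finset.sum_congr rfl fun b _ => key b, Finset.sum_add_distrib, hshift, two_nsmul]

/-- Random shifts by `π` hide an offset that depends only on the shifts at earlier positions,
provided that summing over a shift by `π` at one position removes the dependence on the angle
there. -/
theorem sum_shift_eq_of_causal {V E : Type*} [Fintype V] [DecidableEq V] [AddCommGroup E]
    [Module ℂ E] (col : V → ℕ) (H : (V → ZMod 8) → E)
    (hH : ∀ v g x y, H (Function.update g v x) + H (Function.update g v (x + 4)) =
      H (Function.update g v y) + H (Function.update g v (y + 4)))
    (c : V → (V → ZMod 2) → ZMod 8)
    (hc : ∀ v r r', (∀ u, col u < col v → r u = r' u) → c v r = c v r') :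
    ∑ r : V → ZMod 2, H (fun v => c v r + ((r v).val : ZMod 8) * 4) =
      ∑ r : V → ZMod 2, H (fun v => ((r v).val : ZMod 8) * 4) := by
  -- Induction on the set `s` that supports the offsets. The inserted vertex `a` has maximal `col`
  -- in the set, so no remaining offset depends on `r a`, and the offset at `a` can be erased first.
  suffices h : ∀ (s : Finset V) (c : V → (V → ZMod 2) → ZMod 8),
      (∀ v r r', (∀ u, col u < col v → r u = r' u) → c v r = c v r') →
      (∀ v ∉ s, ∀ r, c v r = 0) →
      ∑ r : V → ZMod 2, H (fun v => c v r + ((r v).val : ZMod 8) * 4) =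
        ∑ r : V → ZMod 2, H (fun v => ((r v).val : ZMod 8) * 4) from
    h Finset.univ c hc (by simp)
  intro s
  induction s using Finset.induction_on_max_value col with
  | empty => intro c _ h0; simp [h0]
  | insert a s ha hmax ih =>
    intro c hc h0
    rw [← ih (fun v r => if v = a then 0 else c v r)
      (fun v r r' h => by rw [hc v r r' h])
      (fun v hv r => by
        split_ifs with h
        · rfl
        · exact h0 v (by simp [h, hv]) r)]
    -- Doubling the sum replaces `r a` at vertex `a` by a fresh bit, which makes the two terms of
    -- `hH` appear.
    have hstep : ∀ c : V → (V → ZMod 2) → ZMod 8,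
        (∀ v r r', (∀ u, u ≠ a → r u = r' u) → c v r = c v r') →
        2 • ∑ r : V → ZMod 2, H (fun v => c v r + ((r v).val : ZMod 8) * 4) =
          ∑ r : V → ZMod 2,
            (H (Function.update (fun v => c v r + ((r v).val : ZMod 8) * 4) a (c a r)) +
              H (Function.update (fun v => c v r + ((r v).val : ZMod 8) * 4) a (c a r + 4))) := by
      intro c hca
      have h := two_nsmul_sum_bits a
        (fun β r => H (Function.update (fun v => c v r + ((r v).val : ZMod 8) * 4) a
          (c a r + (β.val : ZMod 8) * 4))) (by
          intro β r r' h
          congr 1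
          ext v
          by_cases hv : v = a
          · subst hv; simp [hca v r r' h]
          · simp [hv, hca v r r' h, h v hv])
      simp only [Function.update_eq_self] at h
      rw [h]
      refine Finset.sum_congr rfl fun r _ => ?_
      refine (Fin.sum_univ_two _).trans ?_
      congr 3
      change c a r + ((0 : ℕ) : ZMod 8) * 4 = c a r
      simp
    have hca : ∀ v r r', (∀ u, u ≠ a → r u = r' u) → c v r = c v r' := by
      intro v r r' h
      by_cases hv : v ∈ insert a s
      · refine hc v r r' fun u hu => h u ?_
        rintro rfl
        rcases Finset.mem_insert.1 hv with rfl | hv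
        · exact lt_irrefl _ hu
        · exact absurd (hmax v hv) (not_le.2 hu)
      · rw [h0 v hv, h0 v hv]
    have h2 : ∀ x y : E, 2 • x = 2 • y → x = y := by
      intro x y hxy
      have h : (2 : ℂ) • x = (2 : ℂ) • y := by
        simpa [two_smul, two_nsmul] using hxy
      exact smul_right_injective E (two_ne_zero (α := ℂ)) h
    apply h2
    rw [hstep c hca, hstep (fun v r => if v = a then 0 else c v r)
      (fun v r r' h => by rw [hca v r r' h])]
    refine Finset.sum_congr rfl fun r _ => ?_
    -- Old and new offsets differ only at `a`, where the update overwrites them.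
    have hu : ∀ x, Function.update
        (fun v => (if v = a then 0 else c v r) + ((r v).val : ZMod 8) * 4) a x =
        Function.update (fun v => c v r + ((r v).val : ZMod 8) * 4) a x := by
      intro x
      ext v
      by_cases hv : v = a
      · subst hv; simp
      · simp [hv]
    rw [hu, hu]
    exact hH _ _ _ _

/-! ### The single-qubit states -/

theorem phase_add_four (k : ZMod 8) : phase (k + 4) = -phase k := by
  -- Adding `4` may wrap around modulo `8`; in both cases the exponents differ by `iπ`.
  have h : (k + 4).val = k.val + 4 ∨ k.val = (k + 4).val + 4 := by revert k; decide
  unfold phase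
  rcases h with h | h
  · rw [h, show Complex.I * (((k.val + 4 : ℕ) : ℂ) * (Real.pi / 4 : ℂ)) =
      Complex.I * ((k.val : ℂ) * (Real.pi / 4 : ℂ)) + Real.pi * Complex.I by push_cast; ring,
      Complex.exp_add, Complex.exp_pi_mul_I]
    ring
  · rw [h, show Complex.I * ((((k + 4).val + 4 : ℕ) : ℂ) * (Real.pi / 4 : ℂ)) =
      Complex.I * (((k + 4).val : ℂ) * (Real.pi / 4 : ℂ)) + Real.pi * Complex.I by
        push_cast; ring,
      Complex.exp_add, Complex.exp_pi_mul_I]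
    ring

theorem star_phase_mul_self (k : ZMod 8) : star (phase k) * phase k = 1 := by
  have h : ‖phase k‖ = 1 := by
    rw [phase, show Complex.I * ((k.val : ℂ) * (Real.pi / 4 : ℂ)) =
      ((k.val * (Real.pi / 4) : ℝ) : ℂ) * Complex.I by push_cast; ring]
    exact Complex.norm_exp_ofReal_mul_I _
  have := Complex.conj_mul' (phase k)
  rw [h] at this
  simpa using this

theorem ofReal_sqrt_two_mul_self : (Real.sqrt 2 : ℂ) * (Real.sqrt 2 : ℂ) = 2 := by
  rw [← Complex.ofReal_mul, Real.mul_self_sqrt (by norm_num)]; norm_num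

theorem plusState_eq (θ : ZMod 8) :
    plusState θ = !![1 / 2, star (phase θ) / 2; phase θ / 2, 1 / 2] := by
  have h := star_phase_mul_self θ
  rw [mul_comm] at h
  have key : ∀ x y, plusState θ x y =
      (if x = 0 then 1 else phase θ) * star (if y = 0 then 1 else phase θ) / 2 := by
    intro x y
    simp only [plusState, plusKet, Matrix.vecMulVec_apply, Pi.star_apply, star_div₀]
    rw [div_mul_div_comm, Complex.star_def, Complex.conj_ofReal, ofReal_sqrt_two_mul_self]
  ext x y
  rw [key]
  fin_cases x <;> fin_cases y <;> simp
  rw [← Complex.star_def, h, one_div]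

/-- The phase changes sign under a shift by `π`, so the off-diagonal entries cancel. This is the
one-time pad on a single qubit. -/
theorem plusState_add_plusState (θ : ZMod 8) : plusState θ + plusState (θ + 4) = 1 := by
  rw [plusState_eq, plusState_eq, phase_add_four]
  ext x y
  fin_cases x <;> fin_cases y <;> simp <;> norm_num <;> ring

theorem trace_plusState (θ : ZMod 8) : (plusState θ).trace = 1 := by
  rw [plusState_eq]; simp [Matrix.trace_fin_two]; norm_num

theorem posSemidef_plusState (θ : ZMod 8) : (plusState θ).PosSemidef :=
  Matrix.posSemidef_vecMulVec_self_star _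

theorem trace_angleState (δ : ZMod 8) : (angleState δ).trace = 1 := by
  simp [angleState]

theorem posSemidef_angleState (δ : ZMod 8) : (angleState δ).PosSemidef := by
  have h := Matrix.posSemidef_vecMulVec_self_star (Pi.single δ 1 : ZMod 8 → ℂ)
  rwa [Pi.star_single, star_one, ← Matrix.single_eq_single_vecMulVec_single] at h


/-! ### Completely positive and trace preserving maps -/

/-- Tensoring with a fixed operator on the right. -/
def tensorRight {m q : Type*} (τ : Matrix q q ℂ) :
    Matrix m m ℂ →ₗ[ℂ] Matrix (m × q) (m × q) ℂ where
  toFun X := Matrix.of fun x y => X x.1 y.1 * τ x.2 y.2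
  map_add' X Y := by ext; simp [add_mul]
  map_smul' c X := by ext; simp [mul_assoc]

theorem tensorRight_apply {m q : Type*} (τ : Matrix q q ℂ) (X : Matrix m m ℂ) (x y : m × q) :
    tensorRight τ X x y = X x.1 y.1 * τ x.2 y.2 := rfl

theorem tensorRight_add {m q : Type*} (τ τ' : Matrix q q ℂ) :
    tensorRight (m := m) (τ + τ') = tensorRight τ + tensorRight τ' := by
  ext X x y; simp [tensorRight_apply, mul_add]

theorem trace_tensorRight {m q : Type*} [Fintype m] [Fintype q] (τ : Matrix q q ℂ)
    (X : Matrix m m ℂ) : (tensorRight τ X).trace = X.trace * τ.trace := by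
  simp [Matrix.trace, Fintype.sum_prod_type, tensorRight_apply, Finset.sum_mul_sum]

theorem isCompletelyPositive_tensorRight {m q : Type*} [Fintype m] [Fintype q]
    {τ : Matrix q q ℂ} (hτ : τ.PosSemidef) :
    IsCompletelyPositive (tensorRight (m := m) τ) := by
  intro k X hX
  exact (hX.kronecker hτ).submatrix fun p : Fin k × (m × q) => ((p.1, p.2.1), p.2.2)

theorem IsCompletelyPositive.comp {l m n : Type*} {Ψ : Matrix m m ℂ →ₗ[ℂ] Matrix n n ℂ}
    {Φ : Matrix l l ℂ →ₗ[ℂ] Matrix m m ℂ} (hΨ : IsCompletelyPositive Ψ)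
    (hΦ : IsCompletelyPositive Φ) : IsCompletelyPositive (Ψ ∘ₗ Φ) :=
  fun k X hX => hΨ k _ (hΦ k X hX)

theorem IsCompletelyPositive.sum {ι m n : Type*} (s : Finset ι)
    {Φ : ι → Matrix m m ℂ →ₗ[ℂ] Matrix n n ℂ} (h : ∀ i ∈ s, IsCompletelyPositive (Φ i)) :
    IsCompletelyPositive (∑ i ∈ s, Φ i) := by
  intro k X hX
  have : idTensor (∑ i ∈ s, Φ i) X = ∑ i ∈ s, idTensor (Φ i) X := by
    ext p q
    simp [idTensor, LinearMap.sum_apply, Matrix.sum_apply]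
  rw [this]
  exact Matrix.posSemidef_sum s fun i hi => h i hi k X hX

theorem IsCompletelyPositive.smul {m n : Type*} {Φ : Matrix m m ℂ →ₗ[ℂ] Matrix n n ℂ}
    (h : IsCompletelyPositive Φ) {c : ℂ} (hc : 0 ≤ c) : IsCompletelyPositive (c • Φ) := by
  intro k X hX
  exact (h k X hX).smul hc

/-- The partial trace over the left tensor factor, as a linear map. -/
def traceLeft (Q B : Type*) [Fintype Q] :
    Matrix (Q × B) (Q × B) ℂ →ₗ[ℂ] Matrix B B ℂ where
  toFun X := traceAlice X
  map_add' X Y := by ext; simp [traceAlice, Finset.sum_add_distrib]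
  map_smul' c X := by ext; simp [traceAlice, Finset.mul_sum]

theorem traceLeft_apply {Q B : Type*} [Fintype Q] (X : Matrix (Q × B) (Q × B) ℂ) :
    traceLeft Q B X = traceAlice X := rfl

theorem trace_traceAlice {Q B : Type*} [Fintype Q] [Fintype B] (X : Matrix (Q × B) (Q × B) ℂ) :
    (traceAlice X).trace = X.trace := by
  simp [Matrix.trace, traceAlice, Fintype.sum_prod_type_right]

theorem isCompletelyPositive_traceLeft (Q B : Type*) [Fintype Q] :
    IsCompletelyPositive (traceLeft Q B) := by
  intro k X hX
  have : idTensor (traceLeft Q B) X =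
      ∑ q : Q, X.submatrix (fun p : Fin k × B => (p.1, (q, p.2))) (fun p => (p.1, (q, p.2))) := by
    ext p p'
    simp [idTensor, traceLeft, traceAlice, Matrix.sum_apply]
  rw [this]
  exact Matrix.posSemidef_sum _ fun q _ => hX.submatrix _

/-! ### Alice's reduced picture -/

theorem traceAlice_idTensor {A m n : Type*} [Fintype A] (Φ : Matrix m m ℂ →ₗ[ℂ] Matrix n n ℂ)
    (X : Matrix (A × m) (A × m) ℂ) : traceAlice (idTensor Φ X) = Φ (traceAlice X) := by
  have : traceAlice X = ∑ a, Matrix.of fun x y => X (a, x) (a, y) := by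
    ext; simp [traceAlice, Matrix.sum_apply]
  rw [this, map_sum]
  ext
  simp [traceAlice, idTensor, Matrix.sum_apply]

theorem traceAlice_sendToBob {A m q : Type*} [Fintype A] (X : Matrix (A × m) (A × m) ℂ)
    (τ : Matrix q q ℂ) : traceAlice (sendToBob X τ) = tensorRight τ (traceAlice X) := by
  ext
  simp [traceAlice, sendToBob, tensorRight_apply, Finset.sum_mul]

/-- A unitary on the system `Q` has no effect once `Q` is traced out. -/
theorem sum_conjMiddle_diag {R Q B : Type*} [Fintype Q] [DecidableEq Q] (C : Matrix Q Q ℂ)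
    (hC : C.conjTranspose * C = 1) (X : Matrix (R × (Q × B)) (R × (Q × B)) ℂ) (r r' : R)
    (b b' : B) :
    ∑ z, conjMiddle C X (r, (z, b)) (r', (z, b')) = ∑ z, X (r, (z, b)) (r', (z, b')) := by
  have h : ∀ x y, ∑ z, star (C z y) * C z x = if y = x then 1 else 0 := by
    intro x y
    have := congrFun (congrFun hC y) x
    simpa [Matrix.mul_apply, Matrix.one_apply] using this
  simp only [conjMiddle, Matrix.of_apply]
  rw [Finset.sum_comm]
  refine Finset.sum_congr rfl fun x _ => ?_
  rw [Finset.sum_comm]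
  have : ∀ y, ∑ z, C z x * X (r, (x, b)) (r', (y, b')) * star (C z y) =
      X (r, (x, b)) (r', (y, b')) * if y = x then 1 else 0 := by
    intro y
    rw [← h, Finset.mul_sum]
    exact Finset.sum_congr rfl fun z _ => by ring
  simp only [this]
  simp

theorem outputCorrection_isometry {w n : ℕ} (θ : Angles w n) (s : Bits w n) (i : Fin w) :
    (outputCorrection θ s i).conjTranspose * outputCorrection θ s i = 1 := by
  have hU : ∀ U V : Matrix (Fin 2) (Fin 2) ℂ, U.conjTranspose * U = 1 →
      V.conjTranspose * V = 1 → (U * V).conjTranspose * (U * V) = 1 := by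
    intro U V hU hV
    rw [Matrix.conjTranspose_mul, Matrix.mul_assoc, ← Matrix.mul_assoc _ U, hU, Matrix.one_mul, hV]
  have hpow : ∀ (U : Matrix (Fin 2) (Fin 2) ℂ) (k : ℕ), U.conjTranspose * U = 1 →
      (U ^ k).conjTranspose * U ^ k = 1 := by
    intro U k h
    induction k with
    | zero => simp
    | succ k ih => rw [pow_succ]; exact hU _ _ ih h
  have h := star_phase_mul_self (-θ i (Fin.last n))
  simp only [Complex.star_def] at h
  refine hU _ _ (hU _ _ (hpow _ _ ?_) (hpow _ _ ?_)) ?_ <;>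
  · ext x y
    fin_cases x <;> fin_cases y <;> simp [Matrix.mul_apply, h]

/-- The Gram matrix of a tensor product factors over the rows, by exchanging the product with the
sums. -/
theorem layerCorrection_isometry {w n : ℕ} (θ : Angles w n) (s : Bits w n) :
    (layerCorrection θ s).conjTranspose * layerCorrection θ s = 1 := by
  ext x y
  have h : ∀ i, ∑ z, star (outputCorrection θ s i z (x i)) * outputCorrection θ s i z (y i) =
      if x i = y i then 1 else 0 := by
    intro i
    have := congrFun (congrFun (outputCorrection_isometry θ s i) (x i)) (y i)
    simpa [Matrix.mul_apply, Matrix.one_apply] using this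
  simp only [Matrix.mul_apply, Matrix.conjTranspose_apply, layerCorrection, Matrix.of_apply,
    star_prod, ← Finset.prod_mul_distrib]
  rw [← Fintype.prod_sum
    (fun i z => star (outputCorrection θ s i z (x i)) * outputCorrection θ s i z (y i))]
  simp only [h, Matrix.one_apply, Finset.prod_ite_zero, Finset.prod_const_one, Finset.mem_univ,
    true_implies, funext_iff]


/-! ### Rounds and angles -/

theorem roundVertex_injective {w n : ℕ} : Function.Injective (roundVertex (w := w) (n := n)) :=
  finProdFinEquiv.symm.injective

/-- Each vertex is treated once; hence the state before a round cannot depend on that round's tag or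
answer. -/
theorem roundVertex_ne {w n : ℕ} {u t : Fin (n * w)} (h : u < t) :
    ¬ ((roundVertex u).2 = (roundVertex t).2 ∧ (roundVertex u).1 = (roundVertex t).1) :=
  fun h' => h.ne (roundVertex_injective (Prod.ext h'.2 h'.1))

/-- Extends a family of angles on the measured vertices by zero on the last column. -/
def extendAngles {w n : ℕ} (c : Fin w × Fin n → ZMod 8) : Angles w n :=
  fun i => Fin.lastCases (motive := fun _ => ZMod 8) 0 fun j => c (i, j)

/-- This is the causality that `sum_shift_eq_of_causal` needs. A neighbour in column `l + 1 ≤ j`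
contributes the outcome of column `l`, so every outcome used lies strictly before column `j`. -/
theorem correctedAngle_congr {w n : ℕ} (a : Angles w n) {s s' : Bits w n} (i : Fin w) (j : Fin n)
    (h : ∀ k l, l < j → s k l = s' k l) :
    correctedAngle a s i j.castSucc = correctedAngle a s' i j.castSucc := by
  have hx : corrX s i j.castSucc = corrX s' i j.castSucc := by
    cases n with
    | zero => exact j.elim0
    | succ n =>
      cases j using Fin.cases with
      | zero => rfl
      | succ j => exact h _ _ Fin.castSucc_lt_succ
  have hz : corrZ s i j.castSucc = corrZ s' i j.castSucc := by
    unfold corrZ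
    split_ifs
    · rfl
    · refine Finset.sum_congr rfl fun k _ => Finset.sum_congr rfl fun l _ => ?_
      split_ifs with hl
      · exact h _ _ (Fin.succ_le_castSucc_iff.1 hl.2)
      · rfl
  rw [correctedAngle, correctedAngle, hx, hz]

theorem sum_traceAlice_angleBlock {w n : ℕ} {R B : Type*} [Fintype R]
    (ρ : Matrix ((Angles w n × R) × B) ((Angles w n × R) × B) ℂ) :
    ∑ a, traceAlice (angleBlock ρ a) = traceAlice ρ := by
  ext
  simp [traceAlice, angleBlock, Matrix.sum_apply, Fintype.sum_prod_type]

/-! ### Bob's reduced state in a branch with prescribed messages -/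

attribute [instance] BobStrategy.memFintype

section Reduced

variable {w n : ℕ} [NeZero w] {R B B' : Type u} [Fintype B] [Fintype B']

/-- Bob's unnormalised state after the first `t` rounds, as a linear function of his initial state,
in the branch where the qubits that he receives are tagged by `θ`, the angles that he receives are
`δ`, and his answers are `b`. -/
def bobState (S : BobStrategy w n B B') (θ : Angles w n) (δ : Fin w → Fin n → ZMod 8)
    (b : Bits w n) (t : Fin (n * w + 1)) :
    Matrix B B ℂ →ₗ[ℂ] Matrix (S.Mem t) (S.Mem t) ℂ :=
  Fin.induction (motive := fun t => Matrix B B ℂ →ₗ[ℂ] Matrix (S.Mem t) (S.Mem t) ℂ)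
    (S.init ∘ₗ tensorRight (plusState (θ 0 0)))
    (fun t Φ =>
      let j := (roundVertex t).1
      let i := (roundVertex t).2
      S.act t (b i j) ∘ₗ
        tensorRight (Matrix.kronecker (plusState (θ i j.succ)) (angleState (δ i j))) ∘ₗ Φ)
    t

theorem bobState_zero (S : BobStrategy w n B B') (θ : Angles w n) (δ : Fin w → Fin n → ZMod 8)
    (b : Bits w n) : bobState S θ δ b 0 = S.init ∘ₗ tensorRight (plusState (θ 0 0)) := rfl

theorem bobState_succ (S : BobStrategy w n B B') (θ : Angles w n) (δ : Fin w → Fin n → ZMod 8)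
    (b : Bits w n) (t : Fin (n * w)) :
    bobState S θ δ b t.succ = S.act t (b (roundVertex t).2 (roundVertex t).1) ∘ₗ
      tensorRight (Matrix.kronecker (plusState (θ (roundVertex t).2 (roundVertex t).1.succ))
        (angleState (δ (roundVertex t).2 (roundVertex t).1))) ∘ₗ bobState S θ δ b t.castSucc :=
  rfl

/-- Within a branch all classical data are constants, and every operation acts on Bob's factor
alone, so it commutes with the trace over `R`. -/
theorem traceAlice_branchState [Fintype R] (S : BobStrategy w n B B') (a θ : Angles w n)
    (r b : Bits w n) (ρ : Matrix (R × B) (R × B) ℂ) (t : Fin (n * w + 1)) :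
    traceAlice (branchState S a θ r b ρ t) =
      bobState S θ (announcedAngle a θ r b) b t (traceAlice ρ) := by
  induction t using Fin.induction with
  | zero =>
    exact (traceAlice_idTensor _ _).trans (by rw [traceAlice_sendToBob]; rfl)
  | succ t ih =>
    refine (traceAlice_idTensor _ _).trans ?_
    rw [traceAlice_sendToBob, bobState_succ]
    exact congrArg _ (congrArg _ ih)

/-- Bob's state depends only on the qubits and answers of the rounds that are over. -/
theorem bobState_congr (S : BobStrategy w n B B') {θ θ' : Angles w n}
    (δ : Fin w → Fin n → ZMod 8) {b b' : Bits w n} (t : Fin (n * w + 1)) (h0 : θ 0 0 = θ' 0 0)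
    (h : ∀ u : Fin (n * w), u.castSucc < t →
      θ (roundVertex u).2 (roundVertex u).1.succ = θ' (roundVertex u).2 (roundVertex u).1.succ ∧
      b (roundVertex u).2 (roundVertex u).1 = b' (roundVertex u).2 (roundVertex u).1) :
    bobState S θ δ b t = bobState S θ' δ b' t := by
  induction t using Fin.induction with
  | zero => rw [bobState_zero, bobState_zero, h0]
  | succ t ih =>
    have ht := h t Fin.castSucc_lt_succ
    rw [bobState_succ, bobState_succ, ih fun u hu => h u (hu.trans Fin.castSucc_lt_succ),
      ht.1, ht.2]

/-- Averaging the tag of one qubit over a shift by `π` makes Bob's state independent of it. -/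
theorem bobState_add_shift (S : BobStrategy w n B B') (θ : ZMod 8 → Angles w n)
    (δ : Fin w → Fin n → ZMod 8) (b : Bits w n) (i₀ : Fin w) (j₀ : Fin (n + 1))
    (h₀ : ∀ x, θ x i₀ j₀ = x) (h : ∀ x y i j, ¬ (i = i₀ ∧ j = j₀) → θ x i j = θ y i j)
    (t : Fin (n * w + 1)) (x y : ZMod 8) :
    bobState S (θ x) δ b t + bobState S (θ (x + 4)) δ b t =
      bobState S (θ y) δ b t + bobState S (θ (y + 4)) δ b t := by
  induction t using Fin.induction with
  | zero =>
    simp only [bobState_zero, ← LinearMap.comp_add, ← tensorRight_add]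
    by_cases hv : (0 : Fin w) = i₀ ∧ (0 : Fin (n + 1)) = j₀
    · obtain ⟨rfl, rfl⟩ := hv
      simp only [h₀, plusState_add_plusState]
    · rw [h x y 0 0 hv, h (x + 4) (y + 4) 0 0 hv]
  | succ t ih =>
    simp only [bobState_succ]
    by_cases hv : (roundVertex t).2 = i₀ ∧ (roundVertex t).1.succ = j₀
    -- The varying tag is sent in this round: the earlier state does not see it, and the two new
    -- qubits add up to the identity. In every other round the message is constant and the induction
    -- hypothesis applies; this also covers tags that are never sent.
    · obtain ⟨hi, hj⟩ := hv
      have hc : ∀ z, bobState S (θ z) δ b t.castSucc = bobState S (θ 0) δ b t.castSucc := by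
        intro z
        refine bobState_congr S δ _ (h _ _ _ _ ?_) fun u hu => ⟨h _ _ _ _ ?_, rfl⟩
        · rintro ⟨-, h'⟩
          exact Fin.succ_ne_zero _ (hj.trans h'.symm)
        · rintro ⟨h1, h2⟩
          exact roundVertex_ne (Fin.castSucc_lt_castSucc_iff.1 hu)
            ⟨h1.trans hi.symm, Fin.succ_injective _ (h2.trans hj.symm)⟩
      simp only [hc, ← LinearMap.comp_add, ← LinearMap.add_comp, ← tensorRight_add]
      have hk : ∀ z (τ : Matrix (ZMod 8) (ZMod 8) ℂ),
          Matrix.kronecker (plusState (θ z (roundVertex t).2 (roundVertex t).1.succ)) τ +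
          Matrix.kronecker (plusState (θ (z + 4) (roundVertex t).2 (roundVertex t).1.succ)) τ =
          Matrix.kronecker 1 τ := by
        intro z τ
        rw [hi, hj, h₀, h₀, ← plusState_add_plusState z]
        exact (Matrix.add_kronecker _ _ _).symm
      rw [hk, hk]
    · rw [h (x + 4) x _ _ hv, h y x _ _ hv, h (y + 4) x _ _ hv]
      simp only [← LinearMap.comp_add]
      rw [ih]

theorem isCompletelyPositive_bobState (S : BobStrategy w n B B') (θ : Angles w n)
    (δ : Fin w → Fin n → ZMod 8) (b : Bits w n) (t : Fin (n * w + 1)) :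
    IsCompletelyPositive (bobState S θ δ b t) := by
  induction t using Fin.induction with
  | zero =>
    exact S.init_cptp.1.comp (isCompletelyPositive_tensorRight (posSemidef_plusState _))
  | succ t ih =>
    exact (S.act_cp t _).comp ((isCompletelyPositive_tensorRight
      ((posSemidef_plusState _).kronecker (posSemidef_angleState _))).comp ih)

/-- For messages that do not depend on Bob's answers, the total trace is preserved. -/
theorem sum_trace_bobState (S : BobStrategy w n B B') (θ : Angles w n)
    (δ : Fin w → Fin n → ZMod 8) (X : Matrix B B ℂ) (t : Fin (n * w + 1)) :
    2 ^ (t : ℕ) * ∑ b : Bits w n, (bobState S θ δ b t X).trace =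
      (Fintype.card (Bits w n) : ℂ) * X.trace := by
  induction t using Fin.induction with
  | zero =>
    simp [bobState_zero, S.init_cptp.2 _, trace_tensorRight, trace_plusState]
  | succ t ih =>
    rw [← ih, Fin.val_succ, pow_succ, mul_assoc]
    congr 1
    let e : (Fin w × Fin n → ZMod 2) ≃ Bits w n := Equiv.curry _ _ _
    rw [← Equiv.sum_comp e, ← Equiv.sum_comp e]
    -- The state before round `t` ignores the answer of that round, so the extra factor `2` becomes
    -- a free sum over the outcome `β`, and the summed instrument preserves the trace.
    have hsum := two_nsmul_sum_bits ((roundVertex t).2, (roundVertex t).1)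
      (fun β b => (S.act t β (tensorRight (Matrix.kronecker
        (plusState (θ (roundVertex t).2 (roundVertex t).1.succ))
        (angleState (δ (roundVertex t).2 (roundVertex t).1)))
        (bobState S θ δ (e b) t.castSucc X))).trace) (by
          intro β b b' h
          have : bobState S θ δ (e b) t.castSucc = bobState S θ δ (e b') t.castSucc := by
            refine bobState_congr S δ _ rfl fun u hu => ⟨rfl, h _ ?_⟩
            intro h'
            exact roundVertex_ne (Fin.castSucc_lt_castSucc_iff.1 hu)
              ⟨congrArg Prod.fst h', congrArg Prod.snd h'⟩
          rw [this])
    rw [nsmul_eq_mul, Nat.cast_ofNat] at hsum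
    refine hsum.trans (Finset.sum_congr rfl fun b _ => ?_)
    rw [← Matrix.trace_sum, ← LinearMap.sum_apply, S.act_tp t, trace_tensorRight]
    have : (Matrix.kronecker (plusState (θ (roundVertex t).2 (roundVertex t).1.succ))
        (angleState (δ (roundVertex t).2 (roundVertex t).1))).trace = 1 := by
      refine (Matrix.trace_kronecker _ _).trans ?_
      rw [trace_plusState, trace_angleState, one_mul]
    rw [this, mul_one]

/-- Bob's unnormalised final state, as a linear function of his initial state. -/
def bobFinal (S : BobStrategy w n B B') (θ : Angles w n) (δ : Fin w → Fin n → ZMod 8)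
    (b : Bits w n) : Matrix B B ℂ →ₗ[ℂ] Matrix B' B' ℂ :=
  (traceLeft (Fin w → Fin 2) B' ∘ₗ S.final) ∘ₗ bobState S θ δ b (Fin.last (n * w))

theorem isCompletelyPositive_bobFinal (S : BobStrategy w n B B') (θ : Angles w n)
    (δ : Fin w → Fin n → ZMod 8) (b : Bits w n) : IsCompletelyPositive (bobFinal S θ δ b) :=
  ((isCompletelyPositive_traceLeft _ _).comp S.final_cptp.1).comp
    (isCompletelyPositive_bobState S θ δ b _)

theorem sum_trace_bobFinal (S : BobStrategy w n B B') (θ : Angles w n)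
    (δ : Fin w → Fin n → ZMod 8) (X : Matrix B B ℂ) :
    ∑ b : Bits w n, (bobFinal S θ δ b X).trace = X.trace := by
  have h := sum_trace_bobState S θ δ X (Fin.last (n * w))
  have hcard : (Fintype.card (Bits w n) : ℂ) = 2 ^ (n * w) := by
    simp [Bits, ZMod.card, ← pow_mul]
  rw [hcard, Fin.val_last] at h
  have h2 : (2 : ℂ) ^ (n * w) ≠ 0 := by positivity
  rw [← mul_left_cancel₀ h2 h]
  refine Finset.sum_congr rfl fun b _ => ?_
  simp only [bobFinal, LinearMap.comp_apply, traceLeft_apply, trace_traceAlice, S.final_cptp.2 _]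

/-! ### Hiding the computation angles -/

/-- Averaging a shift by `π` of the offset of one tag removes the dependence on that offset. -/
theorem bobFinal_add_shift (S : BobStrategy w n B B') (θ : Angles w n)
    (δ : Fin w → Fin n → ZMod 8) (b : Bits w n) (v : Fin w × Fin n) (g : Fin w × Fin n → ZMod 8)
    (x y : ZMod 8) :
    bobFinal S (θ - extendAngles (Function.update g v x)) δ b +
        bobFinal S (θ - extendAngles (Function.update g v (x + 4))) δ b =
      bobFinal S (θ - extendAngles (Function.update g v y)) δ b +
        bobFinal S (θ - extendAngles (Function.update g v (y + 4))) δ b := by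
  obtain ⟨i₀, j₀⟩ := v
  -- Reparametrised so that `z` is the tag itself at `(i₀, j₀)` instead of the offset subtracted
  -- from it. Shifting the offset by `4` shifts the tag by `4`, since `-4 = 4` modulo `8`.
  let F : ZMod 8 → Angles w n := fun z =>
    θ - extendAngles (Function.update g (i₀, j₀) (θ i₀ j₀.castSucc - z))
  have hF : ∀ x, θ - extendAngles (Function.update g (i₀, j₀) x) =
      F (θ i₀ j₀.castSucc - x) := by
    intro x; simp only [F, sub_sub_cancel]
  have h4 : ∀ x, θ i₀ j₀.castSucc - (x + 4) = θ i₀ j₀.castSucc - x + 4 := by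
    intro x
    have : (-4 : ZMod 8) = 4 := by decide
    rw [← sub_sub, sub_eq_add_neg _ (4 : ZMod 8), this]
  rw [hF, hF, hF, hF, h4, h4]
  have h := bobState_add_shift S F δ b i₀ j₀.castSucc (fun x => ?_) (fun x y i j hij => ?_)
    (Fin.last (n * w)) (θ i₀ j₀.castSucc - x) (θ i₀ j₀.castSucc - y)
  · simp only [bobFinal]
    rw [← LinearMap.comp_add, ← LinearMap.comp_add, h]
  · simp [F, extendAngles]
  · cases j using Fin.lastCases with
    | last => simp [F, extendAngles]
    | cast j =>
      have : (i, j) ≠ (i₀, j₀) := fun h =>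
        hij ⟨congrArg Prod.fst h, congrArg Fin.castSucc (congrArg Prod.snd h)⟩
      simp [F, extendAngles, this]

/-- The average of Bob's final state over Alice's choices does not depend on her angles. -/
theorem sum_bobFinal (S : BobStrategy w n B B') (a : Angles w n) :
    ∑ θ : Angles w n, ∑ r : Bits w n, ∑ b : Bits w n,
        bobFinal S θ (announcedAngle a θ r b) b =
      ∑ θ : Angles w n, ∑ r : Bits w n, ∑ b : Bits w n,
        bobFinal S (θ - extendAngles fun v => ((r v.1 v.2).val : ZMod 8) * 4)
          (fun i j => θ i j.castSucc) b := by
  -- `C r b` is the announced angle minus `θ`. It does not involve `θ`, so translating `θ` by it is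
  -- a bijection.
  let C : Bits w n → Bits w n → Fin w × Fin n → ZMod 8 := fun r b v =>
    correctedAngle a (b + r) v.1 v.2.castSucc + ((r v.1 v.2).val : ZMod 8) * 4
  have h1 : ∀ r b : Bits w n, ∑ θ, bobFinal S θ (announcedAngle a θ r b) b =
      ∑ θ, bobFinal S (θ - extendAngles (C r b)) (fun i j => θ i j.castSucc) b := by
    intro r b
    rw [← Equiv.sum_comp (Equiv.subRight (extendAngles (C r b)))]
    refine Finset.sum_congr rfl fun θ _ => ?_
    rw [Equiv.subRight_apply]
    congr 1
    ext i j
    simp only [announcedAngle, Pi.sub_apply, extendAngles, Fin.lastCases_castSucc, C]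
    ring
  have h2 : ∀ (θ : Angles w n) (b : Bits w n),
      ∑ r, bobFinal S (θ - extendAngles (C r b)) (fun i j => θ i j.castSucc) b =
        ∑ r : Bits w n, bobFinal S (θ - extendAngles fun v => ((r v.1 v.2).val : ZMod 8) * 4)
          (fun i j => θ i j.castSucc) b := by
    intro θ b
    let e : (Fin w × Fin n → ZMod 2) ≃ Bits w n := Equiv.curry _ _ _
    rw [← Equiv.sum_comp e, ← Equiv.sum_comp e]
    refine sum_shift_eq_of_causal (V := Fin w × Fin n) (fun v => (v.2 : ℕ))
      (fun g => bobFinal S (θ - extendAngles g) (fun i j => θ i j.castSucc) b) ?_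
      (fun v r => correctedAngle a (b + e r) v.1 v.2.castSucc) ?_
    · exact fun v g x y => bobFinal_add_shift S θ _ b v g x y
    · rintro ⟨i, j⟩ r r' h
      refine correctedAngle_congr a i j fun k l hl => ?_
      exact congrArg (b k l + ·) (h (k, l) hl)
  calc _ = ∑ r : Bits w n, ∑ b : Bits w n, ∑ θ : Angles w n,
        bobFinal S θ (announcedAngle a θ r b) b := by
        rw [Finset.sum_comm]
        exact Finset.sum_congr rfl fun r _ => Finset.sum_comm
    _ = ∑ r : Bits w n, ∑ b : Bits w n, ∑ θ : Angles w n,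
        bobFinal S (θ - extendAngles (C r b)) (fun i j => θ i j.castSucc) b :=
        Finset.sum_congr rfl fun r _ => Finset.sum_congr rfl fun b _ => h1 r b
    _ = ∑ θ : Angles w n, ∑ b : Bits w n, ∑ r : Bits w n,
        bobFinal S (θ - extendAngles (C r b)) (fun i j => θ i j.castSucc) b := by
        rw [Finset.sum_comm]
        refine (Finset.sum_congr rfl fun b _ => Finset.sum_comm).trans ?_
        exact Finset.sum_comm
    _ = _ := Finset.sum_congr rfl fun θ _ =>
        (Finset.sum_congr rfl fun b _ => h2 θ b).trans Finset.sum_comm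

/-- Bob's reduced evolution, averaged over Alice's choices. -/
def bobChannel (S : BobStrategy w n B B') : Matrix B B ℂ →ₗ[ℂ] Matrix B' B' ℂ :=
  ((Fintype.card (Angles w n) : ℂ)⁻¹ * (Fintype.card (Bits w n) : ℂ)⁻¹) •
    ∑ θ : Angles w n, ∑ r : Bits w n, ∑ b : Bits w n,
      bobFinal S (θ - extendAngles fun v => ((r v.1 v.2).val : ZMod 8) * 4)
        (fun i j => θ i j.castSucc) b

/-- For each `θ` and `r` the messages are fixed in advance, so `sum_trace_bobFinal` applies, and the
prefactor averages over the choices. -/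
theorem isCPTP_bobChannel (S : BobStrategy w n B B') : IsCPTP (bobChannel S) := by
  refine ⟨IsCompletelyPositive.smul (.sum _ fun θ _ => .sum _ fun r _ => .sum _ fun b _ =>
    isCompletelyPositive_bobFinal S _ _ b) (by positivity), fun X => ?_⟩
  simp only [bobChannel, LinearMap.smul_apply, LinearMap.sum_apply, Matrix.trace_smul,
    Matrix.trace_sum, sum_trace_bobFinal, Finset.sum_const, Finset.card_univ, smul_eq_mul,
    nsmul_eq_mul]
  field_simp

theorem sum_branchFinal_diag [Fintype R] (S : BobStrategy w n B B') (a θ : Angles w n)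
    (r b : Bits w n) (ρ : Matrix (R × B) (R × B) ℂ) (x y : B') :
    ∑ c : R, ∑ z, branchFinal S a θ r b ρ (c, (z, x)) (c, (z, y)) =
      bobFinal S θ (announcedAngle a θ r b) b (traceAlice ρ) x y := by
  rw [bobFinal, LinearMap.comp_apply, LinearMap.comp_apply, ← traceAlice_branchState,
    ← traceAlice_idTensor]
  simp only [branchFinal, sum_conjMiddle_diag _ (layerCorrection_isometry θ (b + r))]
  rw [Finset.sum_comm]
  simp only [traceLeft_apply, traceAlice, Matrix.of_apply]

theorem traceAlice_blindProtocolRun [Fintype R] (S : BobStrategy w n B B')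
    (ρ : Matrix ((Angles w n × R) × B) ((Angles w n × R) × B) ℂ) :
    traceAlice (blindProtocolRun S ρ) = bobChannel S (traceAlice ρ) := by
  rw [← sum_traceAlice_angleBlock, map_sum]
  ext x y
  rw [Matrix.sum_apply]
  change ∑ p, blindProtocolRun S ρ (p, x) (p, y) = _
  simp only [Matrix.of_apply, blindProtocolRun, if_true, Fintype.sum_prod_type]
  -- Only the diagonal blocks of the angle register enter the partial trace; each evolves under the
  -- same channel, so correlation or entanglement of `a` with Bob is harmless.
  refine Finset.sum_congr rfl fun a _ => ?_
  rw [bobChannel, ← sum_bobFinal S a]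
  simp only [LinearMap.smul_apply, LinearMap.sum_apply, Matrix.smul_apply, Matrix.sum_apply,
    smul_eq_mul, ← sum_branchFinal_diag, ← Finset.mul_sum]
  congr 1
  have hswap : ∀ f : Angles w n → Bits w n → Bits w n → R → (Fin w → Fin 2) → ℂ,
      ∑ c, ∑ z, ∑ θ, ∑ r, ∑ b, f θ r b c z = ∑ θ, ∑ r, ∑ b, ∑ c, ∑ z, f θ r b c z := by
    intro f
    have h : ∀ g : Angles w n × Bits w n × Bits w n → R × (Fin w → Fin 2) → ℂ,
      ∑ p, ∑ q, g q p = ∑ q, ∑ p, g q p := fun g => Finset.sum_comm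
    simpa only [Fintype.sum_prod_type] using h fun q p => f q.1 q.2.1 q.2.2 p.1 p.2
  exact hswap _

end Reduced

end

theorem mainTheorem4 (w n : ℕ) [NeZero w] (R B B' : Type u)
    [Fintype R] [Fintype B] [Fintype B'] :
    IsBlind (S := BobStrategy w n B B') (A := Angles w n × R) (B := B)
      (A' := (Angles w n × R) × (Fin w → Fin 2)) (B' := B') blindProtocolRun :=
  fun S => ⟨bobChannel S, isCPTP_bobChannel S, fun ρ _ => traceAlice_blindProtocolRun S ρ⟩
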